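/- Let $X$ be a real random variable with an absolutely continuous distribution, mean $\mu$ and finite variance $\sigma_X^2$, and let $\eta\in(0,1/16)$, $\delta\in(0,1)$. Let $\mathcal G$ be a connected undirected graph on a finite set $\mathcal V$ of agents, and for $i\in\mathcal V$ let $\mathcal N_i$ consist of $i$ and its neighbors. At each time $t=1,2,\dots$ every agent $i$ is assigned two points $x_{i,t},y_{i,t}$; for each $i$, the points $x_{i,1},y_{i,1},x_{i,2},y_{i,2},\dots$ are i.i.d. copies of $X$. An adversary who sees all points replaces them by arbitrary values $\tilde x_{i,t},\tilde y_{i,t}$, subject to the restriction that, almost surely, for every agent and every $t$, at most $2\eta t$ of the $2t$ points of that agent up to time $t$ are changed. Let $o\in\mathcal V$ be an agent, possibly chosen at random, whose trimming values are used by all agents: with $\epsilon_t=8\eta+12\log(4/\delta)/t$, let $\alpha_t$ and $\beta_t$ be the $\lceil\epsilon_t t\rceil$-th and the $\lceil(1-\epsilon_t)t\rceil$-th smallest of $\tilde y_{o,1},\dots,\tilde y_{o,t}$ (an index outside $\{1,\dots,t\}$, which can occur only for the finitely many $t$ with $\epsilon_t\ge 1$, is replaced by the nearest element of this set). Let $\phi_{\alpha,\beta}(x)=\beta$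 if $x>\beta$, and otherwise $\phi_{\alpha,\beta}(x)=\alpha$ if $x<\alpha$ and $\phi_{\alpha,\beta}(x)=x$ if $x\ge\alpha$. For a number $K\in\mathbb N$ of communication rounds per time step, the agents compute, starting from $\hat\mu_{i,0}^K=0$, for $t=1,2,\dots$, $$\hat\mu_{i,t}^0=\frac{(t-1)\hat\mu_{i,t-1}^K+\phi_{\alpha_t,\beta_t}(\tilde x_{i,t})}{t},\qquad \hat\mu_{i,t}^{k+1}=\frac1{|\mathcal N_i|}\sum_{j\in\mathcal N_i}\hat\mu_{j,t}^k,\quad k=0,\dots,K-1.$$ Then, for every $K\in\mathbb N=\{0,1,2,\dots\}$, almost surely, for every agent $i\in\mathcal V$, $$\limsup_{t\to\infty}|\hat\mu_{i,t}^K-\mu|\le\frac{\sigma_X}{2\sqrt\eta}.$$ -/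

import Mathlib

open MeasureTheory ProbabilityTheory Filter

noncomputable section

/-- The trimming level `ε_t = 8 η + 12 log (4 / δ) / t`. -/
def trimLevel (η δ : ℝ) (t : ℕ) : ℝ :=
  8 * η + 12 * (Real.log (4 / δ) / (t : ℝ))

/-- The `k`-th smallest value (`k = 1, ..., n + 1`) of the `n + 1` numbers `y 0, ..., y n`, that is,
the `k`-th entry of their non-decreasing rearrangement `y ∘ Tuple.sort y`. An index `k` outside
`{1, ..., n + 1}` is replaced by the nearest admissible one. -/
def orderStat {n : ℕ} (y : Fin (n + 1) → ℝ) (k : ℕ) : ℝ :=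
  (y ∘ Tuple.sort y) ⟨min (k - 1) n, Nat.lt_succ_of_le (Nat.min_le_right _ _)⟩

/-- The lower trimming value at time `t = n + 1`: the order statistic of index `ε_t t` (rounded up)
of the `t` points `y 0, ..., y n` received so far. -/
def lowerTrim (η δ : ℝ) (y : ℕ → ℝ) (n : ℕ) : ℝ :=
  orderStat (fun j : Fin (n + 1) => y j)
    ⌈trimLevel η δ (n + 1) * ((n + 1 : ℕ) : ℝ)⌉₊

/-- The upper trimming value at time `t = n + 1`: the order statistic of index `(1 - ε_t) t`
(rounded up) of the `t` points `y 0, ..., y n` received so far. -/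
def upperTrim (η δ : ℝ) (y : ℕ → ℝ) (n : ℕ) : ℝ :=
  orderStat (fun j : Fin (n + 1) => y j)
    ⌈(1 - trimLevel η δ (n + 1)) * ((n + 1 : ℕ) : ℝ)⌉₊

/-- The trimming operator `φ_{α,β}`. -/
def trim (α β x : ℝ) : ℝ :=
  if β < x then β else if x < α then α else x

variable {V : Type*} [Fintype V] [DecidableEq V]

/-- The inclusive neighbourhood of the agent `i`: its neighbours and `i` itself. -/
def inclNbhd (G : SimpleGraph V) [DecidableRel G.Adj] (i : V) : Finset V :=
  insert i (G.neighborFinset i)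

/-- One round of communication: every agent replaces its estimate by the average of the estimates
over its inclusive neighbourhood. -/
def commRound (G : SimpleGraph V) [DecidableRel G.Adj] (v : V → ℝ) : V → ℝ :=
  fun i => (∑ j ∈ inclNbhd G i, v j) / ((inclNbhd G i).card : ℝ)

/-- The estimates `t ↦ (i ↦ μ̂_{i,t}^K)` of all agents, for given (corrupted) data, when the local
update uses updated trimming thresholds. `x i n` and `y i n` are the two points received by the
agent `i` at time `n + 1`; all agents trim with the trimming values of the agent `o`, computed from
the points `y o`. At time `t = n + 1` every agent first performs the local update
`μ̂_{i,t}^0 = ((t - 1) μ̂_{i,t-1}^K + φ_{α_t,β_t}(x̃_{i,t})) / t`,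
and then `K` rounds of communication take place. -/
def distEstimate (G : SimpleGraph V) [DecidableRel G.Adj] (K : ℕ) (η δ : ℝ) (o : V)
    (x y : V → ℕ → ℝ) : ℕ → V → ℝ
  | 0 => fun _ => 0
  | n + 1 => (commRound G)^[K] fun i =>
      ((n : ℝ) * distEstimate G K η δ o x y n i
        + trim (lowerTrim η δ (y o) n) (upperTrim η δ (y o) n) (x i n)) / ((n : ℝ) + 1)

/-- The number of corrupted points among the first `t` points of a stream:
`z` is the clean stream and `z'` the observed one. -/
def numCorrupted (z z' : ℕ → ℝ) (t : ℕ) : ℕ :=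
  {n : ℕ | n < t ∧ z' n ≠ z n}.ncard

end

/-! Put B = σ/(2√η). By Chebyshev, a clean point lies farther than B from μ with probability at most
4η, so by the strong law fewer than 6ηt of an agent's first t clean `y`-points eventually do.
Corruption adds at most 2ηt, giving fewer than 8ηt ≤ ε_t t far points: too few for the lower
trimming value to fall below μ - B or the upper one to exceed μ + B. Once ε_t ≤ 1/2 the two are
ordered, so every trimmed value, whatever the input, lies within B of μ
(`eventually_abs_trim_sub_le`). Local updates and communication are averages, so the error
accumulated earlier is only diluted, like 1/t (`exists_abs_distEstimate_sub_le`). -/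

open Finset in
theorem card_filter_comp_sort {n : ℕ} (y : Fin (n + 1) → ℝ) (p : ℝ → Prop) [DecidablePred p] :
    #{j | p ((y ∘ Tuple.sort y) j)} = #{j | p (y j)} :=
  Finset.card_equiv (Tuple.sort y) (by simp)

open Finset in
/-- The `k`-th smallest value is at least `a` if fewer than `k` values lie below `a`. -/
theorem le_orderStat {n : ℕ} (y : Fin (n + 1) → ℝ) {k : ℕ} {a : ℝ} (hk : k ≤ n + 1)
    (h : #{j | y j < a} < k) : a ≤ orderStat y k := by
  by_contra hlt
  have := (Tuple.lt_card_lt_iff_apply_lt_of_monotone (Tuple.monotone_sort y)).2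
    (not_le.1 hlt)
  rw [card_filter_comp_sort y (· < a)] at this
  simp only at this
  omega

open Finset in
/-- The `k`-th smallest value is at most `b` if at least `k` values are at most `b`. -/
theorem orderStat_le {n : ℕ} (y : Fin (n + 1) → ℝ) {k : ℕ} {b : ℝ} (hk : 1 ≤ k)
    (h : k ≤ #{j | y j ≤ b}) : orderStat y k ≤ b := by
  refine (Tuple.lt_card_le_iff_apply_le_of_monotone (Tuple.monotone_sort y)).1 ?_
  rw [card_filter_comp_sort y (· ≤ b)]
  simp only
  omega

/-- If less than a proportion `ε_t` of the points is at distance more than `B` from `m`, then both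
trimming values lie on the correct side of the interval `[m - B, m + B]`. -/
theorem trim_bounds {η δ m B : ℝ} {y : ℕ → ℝ} {n : ℕ} (hε : trimLevel η δ (n + 1) < 1)
    (h : (((Finset.range (n + 1)).filter fun j => B < |y j - m|).card : ℝ)
      < trimLevel η δ (n + 1) * ((n + 1 : ℕ) : ℝ)) :
    m - B ≤ lowerTrim η δ y n ∧ upperTrim η δ y n ≤ m + B := by
  have hn : (0 : ℝ) < ((n + 1 : ℕ) : ℝ) := by positivity
  have hc : ((Finset.range (n + 1)).filter fun j => B < |y j - m|).card
      = (Finset.univ.filter fun j : Fin (n + 1) => B < |y j - m|).card := by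
    rw [Finset.card_filter, Finset.card_filter,
      Finset.sum_range fun j => if B < |y j - m| then 1 else 0]
  rw [hc] at h
  constructor
  · refine le_orderStat _ (Nat.ceil_le.2 (by nlinarith)) (Nat.lt_ceil.2 (lt_of_le_of_lt ?_ h))
    refine Nat.cast_le.2 (Finset.card_le_card fun j hj => ?_)
    simp only [Finset.mem_filter, Finset.mem_univ, true_and] at hj ⊢
    exact lt_abs.2 (Or.inr (by linarith))
  · refine orderStat_le _ (Nat.one_le_ceil_iff.2 (mul_pos (by linarith) hn)) (Nat.ceil_le.2 ?_)
    -- Every point is far from `m` or at most `m + B`, so more than (1 - ε_t)t points are at most `m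
    -- + B`.
    have hsum : n + 1 ≤ (Finset.univ.filter fun j : Fin (n + 1) => B < |y j - m|).card
        + (Finset.univ.filter fun j : Fin (n + 1) => y j ≤ m + B).card := by
      refine le_trans (le_of_eq ?_) (Finset.card_union_le _ _)
      rw [← Finset.filter_or, Finset.filter_true_of_mem, Finset.card_univ, Fintype.card_fin]
      intro j _
      by_cases hj : y j ≤ m + B
      · exact Or.inr hj
      · exact Or.inl (lt_abs.2 (Or.inl (by linarith)))
    have hsum' : ((n + 1 : ℕ) : ℝ) ≤ _ := Nat.cast_le.2 hsum
    rw [Nat.cast_add (Finset.card _)] at hsum'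
    linarith

/-- The ordering of `α` and `β` carries each one-sided bound over to the other value; nothing is
needed of `x`. -/
theorem abs_trim_sub_le {α β m B x : ℝ} (hα : m - B ≤ α) (hβ : β ≤ m + B)
    (hαβ : α ≤ β) : |trim α β x - m| ≤ B := by
  rw [abs_le, trim]
  split_ifs <;> constructor <;> linarith

theorem orderStat_mono {n : ℕ} (y : Fin (n + 1) → ℝ) {k l : ℕ} (hkl : k ≤ l) :
    orderStat y k ≤ orderStat y l :=
  Tuple.monotone_sort y (by simp only [Fin.mk_le_mk]; omega)

theorem lowerTrim_le_upperTrim {η δ : ℝ} (y : ℕ → ℝ) {n : ℕ}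
    (hε : trimLevel η δ (n + 1) ≤ 1 / 2) : lowerTrim η δ y n ≤ upperTrim η δ y n :=
  orderStat_mono _ (Nat.ceil_le_ceil (mul_le_mul_of_nonneg_right (by linarith) (by positivity)))

section Averaging

variable {V : Type*} [Fintype V] [DecidableEq V] (G : SimpleGraph V) [DecidableRel G.Adj]

/-- Intervals are convex, and the neighbourhood averaged over is nonempty. -/
theorem abs_commRound_sub_le {v : V → ℝ} {m M : ℝ} (h : ∀ i, |v i - m| ≤ M) (i : V) :
    |commRound G v i - m| ≤ M := by
  have hpos : (0 : ℝ) < (inclNbhd G i).card :=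
    Nat.cast_pos.2 (Finset.card_pos.2 ⟨i, Finset.mem_insert_self _ _⟩)
  have heq : commRound G v i - m
      = (∑ j ∈ inclNbhd G i, (v j - m)) / ((inclNbhd G i).card : ℝ) := by
    rw [commRound, Finset.sum_sub_distrib, Finset.sum_const, nsmul_eq_mul]
    field_simp
  rw [heq, abs_div, abs_of_pos hpos, div_le_iff₀ hpos, mul_comm, ← nsmul_eq_mul]
  exact (Finset.abs_sum_le_sum_abs _ _).trans (Finset.sum_le_card_nsmul _ _ _ fun j _ => h j)

theorem abs_iterate_commRound_sub_le {m M : ℝ} (K : ℕ) :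
    ∀ {v : V → ℝ}, (∀ i, |v i - m| ≤ M) → ∀ i, |(commRound G)^[K] v i - m| ≤ M := by
  induction K with
  | zero => exact fun h => h
  | succ K ih => exact fun h => ih (abs_commRound_sub_le G h)

/-- If all trimmed points are eventually within `B` of `m`, then the distance of the estimates
from `m` is at most `B + O(1 / t)`. -/
theorem exists_abs_distEstimate_sub_le (K : ℕ) {η δ m B : ℝ} {o : V} {x y : V → ℕ → ℝ} {N : ℕ}
    (hB : 0 ≤ B)
    (h : ∀ n ≥ N, ∀ i, |trim (lowerTrim η δ (y o) n) (upperTrim η δ (y o) n) (x i n) - m| ≤ B) :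
    ∃ C : ℝ, ∀ n ≥ N, ∀ i, n * |distEstimate G K η δ o x y n i - m| ≤ C + n * B := by
  -- Summing over agents makes the constant uniform in `i`, as the induction through communication
  -- requires.
  refine ⟨N * ∑ i, |distEstimate G K η δ o x y N i - m|, fun n hn => ?_⟩
  induction n, hn using Nat.le_induction with
  | base =>
    intro i
    have := Finset.single_le_sum (f := fun i => |distEstimate G K η δ o x y N i - m|)
      (fun i _ => abs_nonneg _) (Finset.mem_univ i)
    have h1 := mul_le_mul_of_nonneg_left this (Nat.cast_nonneg (α := ℝ) N)
    have h2 : (0 : ℝ) ≤ N * B := by positivity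
    linarith
  | succ n hn ih =>
    intro i
    set C := N * ∑ i, |distEstimate G K η δ o x y N i - m|
    have hpos : (0 : ℝ) < (n : ℝ) + 1 := by positivity
    -- Divided by `n + 1`, the goal is a bound uniform over agents, which communication preserves.
    rw [Nat.cast_succ, mul_comm, ← le_div_iff₀ hpos, distEstimate]
    refine abs_iterate_commRound_sub_le G K (fun j => ?_) i
    rw [le_div_iff₀ hpos, ← abs_of_pos hpos, ← abs_mul, abs_of_pos hpos]
    have heq : ∀ u v : ℝ, ((n * u + v) / ((n : ℝ) + 1) - m) * ((n : ℝ) + 1)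
        = n * (u - m) + (v - m) := by
      intro u v
      field_simp
      ring
    rw [heq]
    refine (abs_add_le _ _).trans ?_
    rw [abs_mul, Nat.abs_cast]
    linarith [ih j, h n hn j]

theorem limsup_abs_distEstimate_sub_le (K : ℕ) {η δ m B : ℝ} {o : V} {x y : V → ℕ → ℝ}
    (hB : 0 ≤ B)
    (h : ∀ᶠ n in atTop, ∀ i,
      |trim (lowerTrim η δ (y o) n) (upperTrim η δ (y o) n) (x i n) - m| ≤ B) (i : V) :
    limsup (fun t : ℕ => ((|distEstimate G K η δ o x y t i - m| : ℝ) : EReal)) atTop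
      ≤ (B : EReal) := by
  obtain ⟨N, hN⟩ := eventually_atTop.1 h
  obtain ⟨C, hC⟩ := exists_abs_distEstimate_sub_le G K hB hN
  have hlim : Tendsto (fun t : ℕ => ((C / t + B : ℝ) : EReal)) atTop (nhds (B : EReal)) := by
    refine (continuous_coe_real_ereal.tendsto B).comp ?_
    simpa using (tendsto_const_div_atTop_nhds_zero_nat C).add_const B
  rw [← hlim.limsup_eq]
  refine limsup_le_limsup ?_
  filter_upwards [eventually_ge_atTop N, eventually_gt_atTop 0] with t ht ht0
  refine EReal.coe_le_coe_iff.2 ?_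
  have ht' : (0 : ℝ) < t := Nat.cast_pos.2 ht0
  have := hC t ht i
  rw [mul_comm, ← le_div_iff₀ ht', add_div, mul_div_cancel_left₀ _ ht'.ne'] at this
  exact this

end Averaging

/-- Chebyshev's inequality at distance `σ / (2 √η)` from the mean. -/
theorem measureReal_abs_sub_mean_gt_le {Ω : Type*} [MeasurableSpace Ω] {P : Measure Ω}
    [IsProbabilityMeasure P] {X : Ω → ℝ} (hX : MemLp X 2 P) {η : ℝ} (hη : 0 < η) :
    P.real {ω | √(variance X P) / (2 * √η) < |X ω - ∫ a, X a ∂P|} ≤ 4 * η := by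
  refine ENNReal.toReal_le_of_le_ofReal (by positivity) ?_
  -- Chebyshev needs a positive threshold; for zero variance, `X` equals its mean almost surely.
  rcases (variance_nonneg X P).eq_or_lt with h0 | hpos
  · have hae : X =ᵐ[P] fun _ => P[X] := by
      rw [← evariance_eq_zero_iff hX.1.aemeasurable, ← hX.ofReal_variance_eq, ← h0,
        ENNReal.ofReal_zero]
    refine le_of_eq_of_le ?_ zero_le
    rw [measure_eq_zero_iff_ae_notMem]
    filter_upwards [hae] with ω hω
    simp [← h0, hω]
  · have hB : 0 < √(variance X P) / (2 * √η) := by positivity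
    refine (measure_mono (Set.ofPred_subset_ofPred.2 fun ω hω => le_of_lt hω)).trans
      ((meas_ge_le_variance_div_sq hX hB).trans (ENNReal.ofReal_le_ofReal (le_of_eq ?_)))
    rw [div_pow, mul_pow, Real.sq_sqrt hpos.le, Real.sq_sqrt hη.le]
    field_simp
    norm_num

/-- The empirical frequency of a measurable set converges to its probability. -/
theorem ae_tendsto_card_filter_div {Ω Ω₀ : Type*} [MeasurableSpace Ω] [MeasurableSpace Ω₀]
    {P : Measure Ω} {P₀ : Measure Ω₀} [IsProbabilityMeasure P]
    {X : Ω₀ → ℝ} {y : ℕ → Ω → ℝ} (hindep : Pairwise fun m n => IndepFun (y m) (y n) P)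
    (hy : ∀ n, IdentDistrib (y n) X P P₀) {p : ℝ → Prop} [DecidablePred p]
    (hp : MeasurableSet {u | p u}) :
    ∀ᵐ ω ∂P, Tendsto (fun n : ℕ =>
      (((Finset.range n).filter fun j => p (y j ω)).card : ℝ) / n) atTop
      (nhds (P₀.real {ω | p (X ω)})) := by
  set s := {u | p u}
  have hmeas : Measurable (s.indicator (1 : ℝ → ℝ)) := measurable_one.indicator hp
  have hid : ∀ n, IdentDistrib (s.indicator 1 ∘ y n) (s.indicator (1 : ℝ → ℝ) ∘ X) P P₀ :=
    fun n => (hy n).comp hmeas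
  have hint : Integrable (s.indicator (1 : ℝ → ℝ) ∘ y 0) P := by
    refine Integrable.of_bound (hid 0).aemeasurable_fst.aestronglyMeasurable 1
      (Eventually.of_forall fun ω => ?_)
    by_cases h : y 0 ω ∈ s <;> simp [h]
  have hmean : ∫ ω, (s.indicator (1 : ℝ → ℝ) ∘ y 0) ω ∂P = P₀.real {ω | p (X ω)} := by
    rw [(hid 0).integral_eq]
    have : s.indicator (1 : ℝ → ℝ) ∘ X = {ω | p (X ω)}.indicator 1 := rfl
    have hnull : NullMeasurableSet {ω | p (X ω)} P₀ := (hy 0).aemeasurable_snd.nullMeasurable hp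
    rw [this, integral_indicator₀ hnull]
    simp
  have hlaw := strong_law_ae_real (fun n => s.indicator (1 : ℝ → ℝ) ∘ y n) hint
    (fun m n hmn => (hindep hmn).comp hmeas hmeas) (fun n => (hid n).trans (hid 0).symm)
  filter_upwards [hlaw] with ω hω
  rw [hmean] at hω
  refine hω.congr fun n => ?_
  rw [Finset.card_filter, Nat.cast_sum]
  congr 1
  refine Finset.sum_congr rfl fun j _ => ?_
  by_cases h : p (y j ω) <;> simp [s, h]

theorem card_filter_le_add_numCorrupted (z z' : ℕ → ℝ) (p : ℝ → Prop) [DecidablePred p] (t : ℕ) :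
    ((Finset.range t).filter fun j => p (z' j)).card
      ≤ ((Finset.range t).filter fun j => p (z j)).card + numCorrupted z z' t := by
  have hnum : numCorrupted z z' t = ((Finset.range t).filter fun j => z' j ≠ z j).card := by
    rw [numCorrupted, ← Set.ncard_coe_finset]
    congr 1
    ext j
    simp
  rw [hnum]
  refine (Finset.card_le_card fun j hj => ?_).trans (Finset.card_union_le _ _)
  simp only [Finset.mem_union, Finset.mem_filter] at hj ⊢
  by_cases h : z' j = z j
  · exact Or.inl ⟨hj.1, h ▸ hj.2⟩
  · exact Or.inr ⟨hj.1, h⟩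

/-- The limit 8η is below 1/2 precisely because η < 1/16. -/
theorem eventually_trimLevel_le_half {η : ℝ} (δ : ℝ) (hη' : η < 1 / 16) :
    ∀ᶠ n : ℕ in atTop, trimLevel η δ (n + 1) ≤ 1 / 2 := by
  have hlim : Tendsto (fun n : ℕ => trimLevel η δ (n + 1)) atTop (nhds (8 * η + 12 * 0)) :=
    (((tendsto_const_div_atTop_nhds_zero_nat _).const_mul 12).const_add _).comp
      (tendsto_add_atTop_nat 1)
  exact (hlim.eventually_lt_const (by linarith)).mono fun _ => le_of_lt

theorem le_trimLevel {η δ : ℝ} (hδ : 0 < δ) (hδ' : δ < 1) (t : ℕ) : 8 * η ≤ trimLevel η δ t := by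
  have : 0 ≤ Real.log (4 / δ) := Real.log_nonneg ((one_le_div hδ).2 (by linarith))
  rw [trimLevel]
  have : 0 ≤ 12 * (Real.log (4 / δ) / (t : ℝ)) := by positivity
  linarith

/-- If the clean points are asymptotically within `B` of `m` up to a proportion `4 η`, and at most
`2 η t` of the first `t` points are corrupted, then trimming eventually yields values within `B`
of `m`. -/
theorem eventually_abs_trim_sub_le {η δ m B p : ℝ} (hη : 0 < η) (hη' : η < 1 / 16) (hδ : 0 < δ)
    (hδ' : δ < 1) {z z' : ℕ → ℝ} (hp : p ≤ 4 * η)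
    (hfreq : Tendsto (fun n : ℕ =>
      (((Finset.range n).filter fun j => B < |z j - m|).card : ℝ) / n) atTop (nhds p))
    (hcorr : ∀ t : ℕ, (numCorrupted z z' t : ℝ) ≤ η * (2 * t)) :
    ∀ᶠ n in atTop, ∀ x, |trim (lowerTrim η δ z' n) (upperTrim η δ z' n) x - m| ≤ B := by
  -- The constant 6η exceeds the limiting frequency and leaves room for the corrupted 2η below 8η.
  have hfreq' := (hfreq.comp (tendsto_add_atTop_nat 1)).eventually_lt_const
    (show p < 6 * η by linarith)
  filter_upwards [hfreq', eventually_trimLevel_le_half δ hη'] with n hn hε x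
  have hpos : (0 : ℝ) < ((n + 1 : ℕ) : ℝ) := by positivity
  simp only [Function.comp_apply] at hn
  rw [div_lt_iff₀ hpos] at hn
  have hcount := Nat.cast_le (α := ℝ).2
    (card_filter_le_add_numCorrupted z z' (fun u => B < |u - m|) (n + 1))
  rw [Nat.cast_add] at hcount
  have hlevel := mul_le_mul_of_nonneg_right (le_trimLevel (η := η) hδ hδ' (n + 1)) hpos.le
  obtain ⟨hα, hβ⟩ := trim_bounds (η := η) (δ := δ) (m := m) (B := B) (y := z') (n := n)
    (by linarith) (by linarith [hcorr (n + 1)])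
  exact abs_trim_sub_le hα hβ (lowerTrim_le_upperTrim z' hε)

theorem corollary4
    {V : Type*} [Fintype V] [DecidableEq V] (G : SimpleGraph V) [DecidableRel G.Adj]
    (hG : G.Connected)
    -- the random variable `X`
    {Ω₀ : Type*} [MeasurableSpace Ω₀] (P₀ : Measure Ω₀) [IsProbabilityMeasure P₀]
    (X : Ω₀ → ℝ) (hX : MemLp X 2 P₀) (hXac : P₀.map X ≪ volume)
    -- the parameters
    (η δ : ℝ) (hη : 0 < η) (hη' : η < 1 / 16) (hδ : 0 < δ) (hδ' : δ < 1) (K : ℕ)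
    -- the clean data: `x i n` and `y i n` are the points of the agent `i` at time `n + 1`
    {Ω : Type*} [MeasurableSpace Ω] (P : Measure Ω) [IsProbabilityMeasure P]
    (x y : V → ℕ → Ω → ℝ)
    (hindep : ∀ i, iIndepFun (Sum.elim (x i) (y i) : ℕ ⊕ ℕ → Ω → ℝ) P)
    (hx : ∀ i n, IdentDistrib (x i n) X P P₀)
    (hy : ∀ i n, IdentDistrib (y i n) X P P₀)
    -- the data after corruption by an adversary who sees all samples
    (x' y' : V → ℕ → Ω → ℝ)
    (hcorr : ∀ᵐ ω ∂P, ∀ i, ∀ t : ℕ,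
      (numCorrupted (fun n => x i n ω) (fun n => x' i n ω) t
        + numCorrupted (fun n => y i n ω) (fun n => y' i n ω) t : ℝ) ≤ η * (2 * t))
    -- the randomly selected agent whose trimming values are used by all agents
    (o : Ω → V) :
    ∀ᵐ ω ∂P, ∀ i : V,
      limsup (fun t : ℕ =>
        ((|distEstimate G K η δ (o ω) (fun j n => x' j n ω) (fun j n => y' j n ω) t i
            - ∫ a, X a ∂P₀| : ℝ) : EReal)) atTop
        ≤ ((√(variance X P₀) / (2 * √η) : ℝ) : EReal) := by
  set m := ∫ a, X a ∂P₀
  set B := √(variance X P₀) / (2 * √η)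
  have hB : 0 ≤ B := by positivity
  have hs : MeasurableSet {u : ℝ | B < |u - m|} :=
    measurableSet_lt measurable_const (measurable_id.sub_const m).abs
  -- One null set serves all agents, since `o` may depend on `ω` arbitrarily.
  have hfreq : ∀ᵐ ω ∂P, ∀ v, Tendsto (fun n : ℕ =>
      (((Finset.range n).filter fun j => B < |y v j ω - m|).card : ℝ) / n) atTop
      (nhds (P₀.real {a | B < |X a - m|})) :=
    ae_all_iff.2 fun v => ae_tendsto_card_filter_div (p := fun u => B < |u - m|)
      (fun k l hkl => (hindep v).indepFun (Sum.inr_injective.ne hkl)) (hy v) hs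
  filter_upwards [hcorr, hfreq] with ω hc hf
  refine limsup_abs_distEstimate_sub_le G K hB ?_
  have hc' : ∀ t : ℕ, (numCorrupted (fun n => y (o ω) n ω) (fun n => y' (o ω) n ω) t : ℝ)
      ≤ η * (2 * t) := fun t => by
    have := hc (o ω) t
    have h0 : (0 : ℝ) ≤ numCorrupted (fun n => x (o ω) n ω) (fun n => x' (o ω) n ω) t :=
      Nat.cast_nonneg _
    linarith
  exact (eventually_abs_trim_sub_le hη hη' hδ hδ' (measureReal_abs_sub_mean_gt_le hX hη)
    (hf (o ω)) hc').mono fun n hn i => hn _
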